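/- A DG ring is a $\mathbb{Z}$-graded unital associative ring $B=\bigoplus_{i\in\mathbb{Z}}B^i$ with an additive differential $d$ of degree $1$ such that $d\circ d=0$ and $d(ab)=d(a)\,b+(-1)^i a\,d(b)$ for $a\in B^i$. For a simplicial set $X$, let $\operatorname{N}(X,\mathbb{Z})=\bigoplus_{p\ge 0}\operatorname{N}^p(X,\mathbb{Z})$ be the DG ring of normalized integral cochains: $\operatorname{N}^p(X,\mathbb{Z})$ is the group of functions $X_p\to\mathbb{Z}$ that are killed by all codegeneracies (i.e. vanish on degenerate simplices), the differential is $\sum_i(-1)^i\partial^i$, and the product is the Alexander–Whitney product. For a DG ring $B$ put $\operatorname{N}(X,B):=\operatorname{N}(X,\mathbb{Z})\otimes_{\mathbb{Z}}B$ (tensor product of DG rings, with the Koszul sign rule); this is contravariantly functorial in $X$. Let $q\ge 1$, let $0\le i\le q$, let $\sigma:\Lambda^q_i\to\Delta^q$ be the inclusion of the $i$-th horn in the standard $q$-simplex, and let $B$ be any DG ring. Then the DG ring homomorphism $$v:\operatorname{N}(\Delta^q,B)\to\operatorname{N}(\Lambda^q_i,B)$$ induced by $\sigma$ is surjective and is a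 quasi-isomorphism, i.e. it induces an isomorphism on cohomology in every degree. -/

import Mathlib

universe u v w x

noncomputable section

open CategoryTheory Simplicial

namespace CosimplicialRing

open DirectSum

/-- The injection `[p] → [n]` given by the sequence `(0, …, p)`. -/
def front {p n : ℕ} (h : p ≤ n) : ⦋p⦌ ⟶ ⦋n⦌ :=
  SimplexCategory.mkHom
    ⟨fun i => ⟨i, by have := i.isLt; simp at this ⊢; omega⟩, fun i j hij => hij⟩

/-- The injection `[q] → [n]` given by the sequence `(n - q, …, n)`. -/
def back {q n : ℕ} (h : q ≤ n) : ⦋q⦌ ⟶ ⦋n⦌ :=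
  SimplexCategory.mkHom
    ⟨fun i => ⟨n - q + i, by have := i.isLt; simp at this ⊢; omega⟩, fun i j hij => by
      simpa using hij⟩

variable (C : CosimplicialObject RingCat.{u})

/-- The subgroup `N^p(C) ⊆ C^p`, the intersection of the kernels of all the codegeneracies
`s^i : C^p → C^{p-1}` (so that `N^0(C) = C^0`). -/
def normalized (p : ℕ) : AddSubgroup (C.obj ⦋p⦌) :=
  match p with
  | 0 => ⊤
  | n + 1 => ⨅ i : Fin (n + 1), (C.σ i).hom.toAddMonoidHom.ker

variable {C}

lemma normalized_map_eq_zero {p : ℕ} {x : C.obj ⦋p⦌} (hx : x ∈ normalized C p)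
    {m : SimplexCategory} (φ : ⦋p⦌ ⟶ m) (hφ : ¬ Function.Injective φ.toOrderHom) :
    (C.map φ).hom x = 0 := by
  cases p with
  | zero => exact absurd (fun a b _ => Subsingleton.elim (α := Fin 1) a b) hφ
  | succ n =>
    obtain ⟨i, θ, rfl⟩ := SimplexCategory.eq_σ_comp_of_not_injective φ hφ
    have h : (C.σ i).hom x = 0 := (AddSubgroup.mem_iInf.1 hx) i
    rw [C.map_comp, RingCat.hom_comp, RingHom.comp_apply]
    erw [h]
    exact map_zero _

lemma mem_normalized {p : ℕ} {x : C.obj ⦋p⦌}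
    (hx : ∀ (m : ℕ) (φ : ⦋p⦌ ⟶ ⦋m⦌), m < p → (C.map φ).hom x = 0) : x ∈ normalized C p := by
  cases p with
  | zero => exact AddSubgroup.mem_top _
  | succ n => exact AddSubgroup.mem_iInf.2 fun i => hx n _ (Nat.lt_succ_self n)

lemma map_map {a b c : SimplexCategory} (φ : a ⟶ b) (ψ : b ⟶ c) (x : C.obj a) :
    (C.map ψ).hom ((C.map φ).hom x) = (C.map (φ ≫ ψ)).hom x := by
  rw [C.map_comp, RingCat.hom_comp, RingHom.comp_apply]

lemma map_id_apply {a : SimplexCategory} (x : C.obj a) : (C.map (𝟙 a)).hom x = x := by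
  rw [C.map_id]; rfl

lemma not_injective_of_lt {p m : ℕ} (h : m < p) (φ : ⦋p⦌ ⟶ ⦋m⦌) :
    ¬ Function.Injective φ.toOrderHom := fun hi => by
  have := Fintype.card_le_of_injective _ hi
  simp at this
  omega

lemma front_or_back {p q n m : ℕ} (h : p + q = n) (hm : m < n) (φ : ⦋n⦌ ⟶ ⦋m⦌) :
    ¬ Function.Injective (front (show p ≤ n by omega) ≫ φ).toOrderHom ∨
      ¬ Function.Injective (back (show q ≤ n by omega) ≫ φ).toOrderHom := by
  by_contra! hcon
  obtain ⟨h1, h2⟩ := hcon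
  refine not_injective_of_lt hm φ (StrictMono.injective (Fin.strictMono_iff_lt_succ.2 fun i => ?_))
  have m1 := φ.toOrderHom.monotone.comp (front (show p ≤ n by omega)).toOrderHom.monotone
    |>.strictMono_of_injective h1
  have m2 := φ.toOrderHom.monotone.comp (back (show q ≤ n by omega)).toOrderHom.monotone
    |>.strictMono_of_injective h2
  rcases lt_or_ge i.val p with hi | hi
  · exact m1 (a := (⟨i, by simp; omega⟩ : Fin (p + 1))) (b := (⟨i + 1, by simp; omega⟩ : Fin (p+1)))
      (by simp [Fin.lt_def])
  · have hn := i.isLt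
    simp only [SimplexCategory.len_mk] at hn
    have := m2 (a := (⟨i - p, by simp; omega⟩ : Fin (q + 1)))
      (b := (⟨i - p + 1, by simp; omega⟩ : Fin (q + 1)))
      (by simp [Fin.lt_def])
    have e1 : (back (show q ≤ n by omega)).toOrderHom (⟨i - p, by simp; omega⟩ : Fin (q + 1))
      = i.castSucc := Fin.ext (show n - q + (i.val - p) = i.val by omega)
    have e2 : (back (show q ≤ n by omega)).toOrderHom (⟨i - p + 1, by simp; omega⟩ : Fin (q + 1))
      = i.succ := Fin.ext (show n - q + (i.val - p + 1) = i.val + 1 by omega)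
    simp only [Function.comp_apply, e1, e2] at this
    exact this

/-- The Alexander-Whitney product `b * c = ∂^{> p}(b) ⬝ ∂^{< p}(c)` in `N^{p+q}(C)`, for
`b ∈ N^p(C)` and `c ∈ N^q(C)`. The target degree `n` is kept as a variable equal to `p + q`. -/
def awMul {p q n : ℕ} (h : p + q = n) (b : normalized C p) (c : normalized C q) :
    normalized C n :=
  ⟨(C.map (front (show p ≤ n by omega))).hom b * (C.map (back (show q ≤ n by omega))).hom c,
    mem_normalized fun m φ hm => by
      rw [map_mul, map_map, map_map]
      rcases front_or_back h hm φ with h | h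
      · rw [normalized_map_eq_zero b.2 _ h, zero_mul]
      · rw [normalized_map_eq_zero c.2 _ h, mul_zero]⟩

/-- The alternating sum `∑ i, (-1)^i ∂^i : C^p → C^{p+1}` of the coboundary operators. -/
def coboundary {p : ℕ} : C.obj ⦋p⦌ →+ C.obj ⦋p + 1⦌ :=
  ∑ i : Fin (p + 2), (-1 : ℤ) ^ (i : ℕ) • (C.δ i).hom.toAddMonoidHom

lemma coboundary_apply {p : ℕ} (x : C.obj ⦋p⦌) :
    coboundary x = ∑ i : Fin (p + 2), (-1 : ℤ) ^ (i : ℕ) • (C.δ i).hom x := by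
  simp [coboundary]

lemma coboundary_mem {p : ℕ} {x : C.obj ⦋p⦌} (hx : x ∈ normalized C p) :
    coboundary x ∈ normalized C (p + 1) := by
  refine AddSubgroup.mem_iInf.2 fun j => ?_
  show (C.σ j).hom (coboundary x) = 0
  rw [coboundary_apply, map_sum]
  have key : ∀ i : Fin (p + 2), (C.σ j).hom ((-1 : ℤ) ^ (i : ℕ) • (C.δ i).hom x) =
      if i = j.castSucc then (-1 : ℤ) ^ (j : ℕ) • x
      else if i = j.succ then - ((-1 : ℤ) ^ (j : ℕ) • x) else 0 := by
    intro i
    rw [map_zsmul]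
    have e : (C.σ j).hom ((C.δ i).hom x) =
      (C.map (SimplexCategory.δ i ≫ SimplexCategory.σ j)).hom x := map_map _ _ _
    rw [e]
    split_ifs with h1 h2
    · subst h1
      rw [SimplexCategory.δ_comp_σ_self, map_id_apply]; simp
    · subst h2
      rw [SimplexCategory.δ_comp_σ_succ, map_id_apply]; simp [pow_succ]
    · rw [normalized_map_eq_zero hx, smul_zero]
      intro hinj
      have hinj' : Function.Injective (fun k => (j.predAbove (i.succAbove k))) := hinj
      have h3 : i.succAbove.Injective := Fin.succAbove_right_injective
      obtain ⟨k, hk⟩ := Fin.exists_succAbove_eq (Ne.symm h1)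
      obtain ⟨l, hl⟩ := Fin.exists_succAbove_eq (Ne.symm h2)
      have : k = l := hinj' (by simp [hk, hl])
      subst this
      have := hk.symm.trans hl
      simp [Fin.ext_iff] at this
  rw [Finset.sum_congr rfl fun i _ => key i]
  have : ∀ i : Fin (p + 2), (if i = j.castSucc then (-1 : ℤ) ^ (j : ℕ) • x
      else if i = j.succ then - ((-1 : ℤ) ^ (j : ℕ) • x) else 0) =
      (if i = j.castSucc then (-1 : ℤ) ^ (j : ℕ) • x else 0) +
      (if i = j.succ then - ((-1 : ℤ) ^ (j : ℕ) • x) else 0) := by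
    intro i
    split_ifs with h1 h2
    · subst h1; simp [Fin.ext_iff] at h2
    all_goals simp
  rw [Finset.sum_congr rfl fun i _ => this i, Finset.sum_add_distrib]
  simp

lemma coboundary_coboundary {p : ℕ} (x : C.obj ⦋p⦌) : coboundary (coboundary x) = 0 := by
  have h := AlgebraicTopology.AlternatingCofaceMapComplex.d_squared
    (((CosimplicialObject.whiskering _ _).obj (forget₂ RingCat AddCommGrpCat)).obj C) p
  have e : ∀ n : ℕ, AlgebraicTopology.AlternatingCofaceMapComplex.objD
      (((CosimplicialObject.whiskering _ _).obj (forget₂ RingCat AddCommGrpCat)).obj C) n =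
        AddCommGrpCat.ofHom (coboundary (C := C) (p := n)) := by
    intro n
    refine Eq.trans ?_ (map_sum (AddCommGrpCat.homAddEquiv (M := AddCommGrpCat.of (C.obj ⦋n⦌))
      (N := AddCommGrpCat.of (C.obj ⦋n + 1⦌))).symm _ _).symm
    rfl
  rw [e, e] at h
  exact ConcreteCategory.congr_hom h x

lemma hom_ext_val {a b : ℕ} {f g : ⦋a⦌ ⟶ ⦋b⦌}
    (h : ∀ i : Fin (a + 1), (f.toOrderHom i).val = (g.toOrderHom i).val) : f = g := by
  ext i : 3
  exact Fin.ext (h i)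

lemma awMul_assoc {p q r a b n : ℕ} (h₁ : p + q = a) (h₂ : a + r = n) (h₃ : q + r = b)
    (h₄ : p + b = n) (x : normalized C p) (y : normalized C q) (z : normalized C r) :
    awMul h₂ (awMul h₁ x y) z = awMul h₄ x (awMul h₃ y z) := by
  apply Subtype.ext
  have e1 : front (show p ≤ a by omega) ≫ front (show a ≤ n by omega) =
    front (show p ≤ n by omega) := rfl
  have e2 : back (show q ≤ a by omega) ≫ front (show a ≤ n by omega) =
      front (show q ≤ b by omega) ≫ back (show b ≤ n by omega) :=
    hom_ext_val fun i => show a - q + i.val = n - b + i.val by omega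
  have e3 : back (show r ≤ b by omega) ≫ back (show b ≤ n by omega) =
      back (show r ≤ n by omega) :=
    hom_ext_val fun i => show n - b + (b - r + i.val) = n - r + i.val by omega
  simp only [awMul, map_mul, map_map, mul_assoc, e1, e2, e3]

variable (C) in
/-- The unit of `C^0`. -/
def oneN : normalized C 0 := ⟨1, AddSubgroup.mem_top _⟩

lemma one_awMul {p : ℕ} (h : 0 + p = p) (x : normalized C p) : awMul h (oneN C) x = x := by
  apply Subtype.ext
  have e : back (le_refl p) = 𝟙 _ :=
    hom_ext_val fun i => show p - p + i.val = i.val by omega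
  simp only [awMul, oneN, map_one, one_mul, e, map_id_apply]

lemma awMul_one {p : ℕ} (h : p + 0 = p) (x : normalized C p) : awMul h x (oneN C) = x := by
  apply Subtype.ext
  have e : front (le_refl p) = 𝟙 _ := rfl
  simp only [awMul, oneN, map_one, mul_one, e, map_id_apply]

instance : GradedMonoid.GMul (fun p => normalized C p) where
  mul b c := awMul rfl b c

instance : GradedMonoid.GOne (fun p => normalized C p) where
  one := oneN C

lemma mk_awMul {p q n : ℕ} (h : p + q = n) (b : normalized C p) (c : normalized C q) :
    (GradedMonoid.mk p b * GradedMonoid.mk q c : GradedMonoid fun p => normalized C p) =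
      GradedMonoid.mk n (awMul h b c) := by
  subst h; rfl

instance : GRing (fun p => normalized C p) where
  mul_zero b := Subtype.ext (by simp [GradedMonoid.GMul.mul, awMul])
  zero_mul b := Subtype.ext (by simp [GradedMonoid.GMul.mul, awMul])
  mul_add b c d := Subtype.ext (by simp [GradedMonoid.GMul.mul, awMul, mul_add])
  add_mul b c d := Subtype.ext (by simp [GradedMonoid.GMul.mul, awMul, add_mul])
  one_mul x := (mk_awMul (zero_add x.1) (oneN C) x.2).trans (by rw [one_awMul]; rfl)
  mul_one x := (mk_awMul (add_zero x.1) x.2 (oneN C)).trans (by rw [awMul_one]; rfl)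
  mul_assoc x y z := by
    obtain ⟨p, x⟩ := x
    obtain ⟨q, y⟩ := y
    obtain ⟨r, z⟩ := z
    have h₁ := mk_awMul rfl (awMul rfl x y) z
    have h₂ := mk_awMul (add_assoc p q r).symm x (awMul rfl y z)
    rw [awMul_assoc rfl rfl rfl (add_assoc p q r).symm] at h₁
    exact h₁.trans h₂.symm
  natCast n := n • oneN C
  natCast_zero := zero_smul _ _
  natCast_succ n := succ_nsmul _ _
  intCast n := n • oneN C
  intCast_ofNat n := natCast_zsmul _ _
  intCast_negSucc_ofNat n := negSucc_zsmul _ _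

/-- The function `j ↦ j` for `j < k` and `j ↦ j + 1` for `j ≥ k`, that is `∂^k` when `k ≤ n + 1`. -/
def stepOver (n k : ℕ) : ⦋n⦌ ⟶ ⦋n + 1⦌ :=
  SimplexCategory.mkHom
    ⟨fun i => ⟨if i.val < k then i.val else i.val + 1, by
      have := i.isLt; simp at this ⊢; split_ifs <;> omega⟩, fun i j hij => by
      have : i.val ≤ j.val := hij
      show (if i.val < k then i.val else i.val + 1) ≤ (if j.val < k then j.val else j.val + 1)
      split_ifs <;> omega⟩

lemma coboundary_eq {n : ℕ} (x : C.obj ⦋n⦌) : coboundary x =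
    ∑ k ∈ Finset.range (n + 2), (-1 : ℤ) ^ k • (C.map (stepOver n k)).hom x := by
  rw [coboundary_apply, Finset.sum_range]
  refine Finset.sum_congr rfl fun i _ => ?_
  have : SimplexCategory.δ i = stepOver n i := hom_ext_val fun j => by
    show (i.succAbove j).val = if j.val < i.val then j.val else j.val + 1
    simp only [Fin.succAbove, Fin.lt_def, Fin.val_castSucc]
    split_ifs <;> rfl
  rw [← this]
  rfl

/-- The coboundary restricted to normalized cochains. -/
def dN (p : ℕ) : normalized C p →+ normalized C (p + 1) :=
  (coboundary.comp (normalized C p).subtype).codRestrict _ fun x => coboundary_mem x.2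

lemma dN_awMul {p q n : ℕ} (h : p + q = n) (b : normalized C p) (c : normalized C q) :
    dN n (awMul h b c) = awMul (show p + 1 + q = n + 1 by omega) (dN p b) c +
      (-1 : ℤ) ^ p • awMul (show p + (q + 1) = n + 1 by omega) b (dN q c) := by
  apply Subtype.ext
  have hp : p ≤ n + 1 := by omega
  have hq : q ≤ n + 1 := by omega
  have hp' : p + 1 ≤ n + 1 := by omega
  have hq' : q + 1 ≤ n + 1 := by omega
  have hp'' : p ≤ n := by omega
  have hq'' : q ≤ n := by omega
  show coboundary ((C.map (front hp'')).hom b * (C.map (back hq'')).hom c) =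
    (C.map (front hp')).hom (coboundary b.1) * (C.map (back hq)).hom c +
      (-1 : ℤ) ^ p • ((C.map (front hp)).hom b * (C.map (back hq')).hom (coboundary c.1))
  simp only [coboundary_eq, map_sum, map_mul, map_zsmul, map_map, Finset.sum_mul, Finset.mul_sum,
    smul_mul_assoc, mul_smul_comm]
  have e1 : ∀ k ∈ Finset.range (p + 1), front hp'' ≫ stepOver n k = stepOver p k ≫ front hp' :=
    fun k _ => rfl
  have e2 : ∀ k ∈ Finset.range (p + 1), back hq'' ≫ stepOver n k = back hq :=
    fun k hk => hom_ext_val fun i => by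
      have := Finset.mem_range.1 hk
      show (if n - q + i.val < k then n - q + i.val else n - q + i.val + 1) = n + 1 - q + i.val
      split_ifs <;> omega
  have e3 : ∀ j, front hp'' ≫ stepOver n (p + 1 + j) = front hp :=
    fun j => hom_ext_val fun i => by
      have := i.isLt
      show (if i.val < p + 1 + j then i.val else i.val + 1) = i.val
      split_ifs <;> omega
  have e4 : ∀ j, back hq'' ≫ stepOver n (p + 1 + j) = stepOver q (j + 1) ≫ back hq' :=
    fun j => hom_ext_val fun i => by
      show (if n - q + i.val < p + 1 + j then n - q + i.val else n - q + i.val + 1) =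
        n + 1 - (q + 1) + (if i.val < j + 1 then i.val else i.val + 1)
      split_ifs <;> omega
  have e5 : stepOver p (p + 1) ≫ front hp' = front hp := hom_ext_val fun i => by
      have := i.isLt
      show (if i.val < p + 1 then i.val else i.val + 1) = i.val
      simp; omega
  have e6 : stepOver q 0 ≫ back hq' = back hq := hom_ext_val fun i => by
      show n + 1 - (q + 1) + (if i.val < 0 then i.val else i.val + 1) = n + 1 - q + i.val
      simp; omega
  rw [show n + 2 = (p + 1) + (q + 1) by omega, Finset.sum_range_add, Finset.sum_range_succ _ (p + 1),
    Finset.sum_range_succ' _ (q + 1), e5, e6, smul_add, Finset.smul_sum]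
  simp only [smul_smul, pow_zero, mul_one]
  have s1 : ∀ k ∈ Finset.range (p + 1), (-1 : ℤ) ^ k • ((C.map (front hp'' ≫ stepOver n k)).hom b.1 *
      (C.map (back hq'' ≫ stepOver n k)).hom c.1) = (-1 : ℤ) ^ k •
        ((C.map (stepOver p k ≫ front hp')).hom b.1 * (C.map (back hq)).hom c.1) := fun k hk => by
    rw [e1 k hk, e2 k hk]
  rw [Finset.sum_congr rfl s1]
  simp only [e3, e4]
  have s2 : ∀ j : ℕ, (-1 : ℤ) ^ (p + 1 + j) = (-1) ^ p * (-1) ^ (j + 1) := fun j => by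
    rw [← pow_add]; congr 1; omega
  simp only [s2, pow_succ (-1 : ℤ) p, mul_neg, mul_one, neg_smul]
  abel

variable (C) in
/-- The underlying graded group `⨁ p, N^p(C)` of the normalization of a cosimplicial ring. Its ring
structure is the one given by the Alexander-Whitney product in each bidegree. -/
abbrev Normalization : Type u := ⨁ p, normalized C p

variable (C) in
/-- The grading of the normalization by all integers: the piece of degree `n` is `N^n(C)` for
`n ≥ 0` and is zero for `n < 0`. -/
def degN (n : ℤ) : Submodule ℤ (Normalization C) where
  carrier := {x | ∀ p : ℕ, (p : ℤ) ≠ n → x p = 0}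
  zero_mem' p _ := rfl
  add_mem' hx hy p hp := by rw [DirectSum.add_apply, hx p hp, hy p hp, add_zero]
  smul_mem' c x hx p hp := by
    have : (c • x) p = c • x p := rfl
    rw [this, hx p hp, smul_zero]

lemma of_mul_of' {p q n : ℕ} (h : p + q = n) (b : normalized C p) (c : normalized C q) :
    DirectSum.of (fun p => normalized C p) p b * DirectSum.of (fun p => normalized C p) q c =
      DirectSum.of (fun p => normalized C p) n (awMul h b c) := by
  subst h
  exact DirectSum.of_mul_of _ _

lemma of_mem_degN {p : ℕ} (x : normalized C p) :
    DirectSum.of (fun p => normalized C p) p x ∈ degN C p := fun q hq =>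
  DirectSum.of_eq_of_ne (β := fun p => normalized C p) p q x (fun h => hq (congrArg _ h))

lemma eq_of_of_mem_degN {p : ℕ} {x : Normalization C} (hx : x ∈ degN C p) :
    x = DirectSum.of (fun p => normalized C p) p (x p) := by
  refine DFinsupp.ext fun q => ?_
  by_cases h : q = p
  · subst h; exact (DirectSum.of_eq_same (β := fun p => normalized C p) _ _).symm
  · rw [DirectSum.of_eq_of_ne (β := fun p => normalized C p) _ _ _ h, hx q (by simpa using h)]

lemma eq_zero_of_mem_degN {n : ℤ} {x : Normalization C} (hx : x ∈ degN C n) (hn : ∀ p : ℕ, (p : ℤ) ≠ n) :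
    x = 0 := DFinsupp.ext fun q => hx q (hn q)

lemma degN_cases {n : ℤ} {x : Normalization C} (hx : x ∈ degN C n) : x = 0 ∨
    ∃ (p : ℕ) (y : normalized C p), n = p ∧ x = DirectSum.of (fun p => normalized C p) p y := by
  by_cases h : ∃ p : ℕ, (p : ℤ) = n
  · obtain ⟨p, rfl⟩ := h
    exact Or.inr ⟨p, _, rfl, eq_of_of_mem_degN hx⟩
  · push Not at h
    exact Or.inl (eq_zero_of_mem_degN hx h)

variable (C) in
/-- The decomposition of an element of the normalization into homogeneous components. -/
def decomposeN : Normalization C →+ ⨁ n : ℤ, degN C n :=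
  DirectSum.toAddMonoid fun p =>
    (DirectSum.of (fun n : ℤ => degN C n) p).comp
      ((DirectSum.of (fun p => normalized C p) p).codRestrict (degN C p) of_mem_degN)

lemma decomposeN_of {p : ℕ} (y : normalized C p) :
    decomposeN C (DirectSum.of (fun p => normalized C p) p y) =
      DirectSum.of (fun n : ℤ => degN C n) p ⟨_, of_mem_degN y⟩ := by
  rw [decomposeN, DirectSum.toAddMonoid_of]; rfl

lemma coe_decomposeN (x : Normalization C) :
    DirectSum.coeAddMonoidHom (degN C) (decomposeN C x) = x := by
  induction x using DirectSum.induction_on with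
  | zero => rw [map_zero, map_zero]
  | add b c hb hc => rw [map_add, map_add, hb, hc]
  | of p y => rw [decomposeN_of, DirectSum.coeAddMonoidHom_of]

lemma decomposeN_coe (x : ⨁ n : ℤ, degN C n) :
    decomposeN C (DirectSum.coeAddMonoidHom (degN C) x) = x := by
  induction x using DirectSum.induction_on with
  | zero => rw [map_zero, map_zero]
  | add b c hb hc => rw [map_add, map_add, hb, hc]
  | of n y =>
    obtain ⟨y, hy⟩ := y
    rw [DirectSum.coeAddMonoidHom_of]
    rcases degN_cases hy with rfl | ⟨p, y, rfl, rfl⟩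
    · rw [map_zero]
      exact (map_zero (DirectSum.of (fun n : ℤ => degN C n) n)).symm
    · exact decomposeN_of y

lemma one_mem_degN : (1 : Normalization C) ∈ degN C 0 := of_mem_degN (oneN C)

lemma mul_mem_degN {i j : ℤ} {x y : Normalization C} (hx : x ∈ degN C i) (hy : y ∈ degN C j) :
    x * y ∈ degN C (i + j) := by
  rcases degN_cases hx with rfl | ⟨p, x, rfl, rfl⟩
  · rw [zero_mul]; exact zero_mem _
  rcases degN_cases hy with rfl | ⟨q, y, rfl, rfl⟩
  · rw [mul_zero]; exact zero_mem _
  rw [of_mul_of' rfl]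
  exact_mod_cast of_mem_degN (awMul rfl x y)

instance : GradedAlgebra (degN C) where
  one_mem := one_mem_degN
  mul_mem _ _ _ _ hx hy := mul_mem_degN hx hy
  decompose' := decomposeN C
  left_inv := coe_decomposeN
  right_inv := decomposeN_coe

variable (C) in
/-- The differential of the normalization. -/
def differentialN : Normalization C →+ Normalization C :=
  DirectSum.toAddMonoid fun p => (DirectSum.of (fun p => normalized C p) (p + 1)).comp (dN p)

lemma differentialN_of {p : ℕ} (x : normalized C p) :
    differentialN C (DirectSum.of (fun p => normalized C p) p x) =
      DirectSum.of (fun p => normalized C p) (p + 1) (dN p x) := by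
  rw [differentialN, DirectSum.toAddMonoid_of]; rfl

lemma differentialN_differentialN (x : Normalization C) : differentialN C (differentialN C x) = 0 := by
  induction x using DirectSum.induction_on with
  | zero => rw [map_zero, map_zero]
  | add b c hb hc => rw [map_add, map_add, hb, hc, add_zero]
  | of p y =>
    have : dN (p + 1) (dN p y) = 0 := Subtype.ext (coboundary_coboundary y.1)
    rw [differentialN_of, differentialN_of, this, map_zero]

lemma differentialN_mem {n : ℤ} {a : Normalization C} (ha : a ∈ degN C n) :
    differentialN C a ∈ degN C (n + 1) := by
  rcases degN_cases ha with rfl | ⟨p, x, rfl, rfl⟩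
  · rw [map_zero]; exact zero_mem _
  rw [differentialN_of]
  exact_mod_cast of_mem_degN (dN p x)

lemma differentialN_mul {n : ℤ} {a : Normalization C} (ha : a ∈ degN C n) (b : Normalization C) :
    differentialN C (a * b) =
      differentialN C a * b + n.negOnePow • (a * differentialN C b) := by
  rcases degN_cases ha with rfl | ⟨p, x, rfl, rfl⟩
  · rw [map_zero, zero_mul, zero_mul, smul_zero, map_zero, add_zero]
  induction b using DirectSum.induction_on with
  | zero => rw [map_zero, mul_zero, mul_zero, smul_zero, map_zero, add_zero]
  | add b c hb hc => rw [mul_add, map_add, hb, hc, map_add, mul_add, mul_add, smul_add]; abel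
  | of q y =>
    rw [of_mul_of' rfl, differentialN_of, differentialN_of, differentialN_of, dN_awMul,
      of_mul_of' (show p + 1 + q = p + q + 1 by omega),
      of_mul_of' (show p + (q + 1) = p + q + 1 by omega), map_add, map_zsmul]
    simp [Int.negOnePow, Units.smul_def]

variable {C' : CosimplicialObject RingCat.{u}}

lemma app_map (f : C ⟶ C') {a b : SimplexCategory} (φ : a ⟶ b) (x : C.obj a) :
    (f.app b).hom ((C.map φ).hom x) = (C'.map φ).hom ((f.app a).hom x) :=
  congrArg (fun g : C.obj a ⟶ C'.obj b => g.hom x) (f.naturality φ)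

/-- The map `N^p(C) → N^p(C')` induced by a map of cosimplicial rings. -/
def normalizedMap (f : C ⟶ C') (p : ℕ) : normalized C p →+ normalized C' p :=
  ((f.app ⦋p⦌).hom.toAddMonoidHom.comp (normalized C p).subtype).codRestrict _ fun x =>
    mem_normalized fun m φ hm => by
      change (C'.map φ).hom ((f.app ⦋p⦌).hom x.1) = 0
      rw [← app_map, normalized_map_eq_zero x.2 φ (not_injective_of_lt hm φ), map_zero]

/-- The map induced on normalizations by a map of cosimplicial rings. -/
def mapN (f : C ⟶ C') : Normalization C →+ Normalization C' :=
  DirectSum.toAddMonoid fun p =>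
    (DirectSum.of (fun p => normalized C' p) p).comp (normalizedMap f p)

lemma mapN_of (f : C ⟶ C') {p : ℕ} (x : normalized C p) :
    mapN f (DirectSum.of (fun p => normalized C p) p x) =
      DirectSum.of (fun p => normalized C' p) p (normalizedMap f p x) := by
  rw [mapN, DirectSum.toAddMonoid_of]; rfl

lemma normalizedMap_awMul (f : C ⟶ C') {p q n : ℕ} (h : p + q = n) (b : normalized C p)
    (c : normalized C q) :
    normalizedMap f n (awMul h b c) = awMul h (normalizedMap f p b) (normalizedMap f q c) := by
  apply Subtype.ext
  change (f.app ⦋n⦌).hom (_ * _) = _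
  rw [map_mul, app_map, app_map]
  rfl

lemma mapN_mul (f : C ⟶ C') (x y : Normalization C) : mapN f (x * y) = mapN f x * mapN f y := by
  induction x using DirectSum.induction_on with
  | zero => rw [zero_mul, map_zero, zero_mul]
  | add a b ha hb => rw [add_mul, map_add, map_add, ha, hb, add_mul]
  | of p b =>
    induction y using DirectSum.induction_on with
    | zero => rw [mul_zero, map_zero, mul_zero]
    | add a b ha hb => rw [mul_add, map_add, map_add, ha, hb, mul_add]
    | of q c =>
      rw [of_mul_of' rfl, mapN_of, mapN_of, mapN_of, of_mul_of' rfl, normalizedMap_awMul]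

lemma mapN_one (f : C ⟶ C') : mapN f 1 = 1 := by
  refine (mapN_of f (oneN C)).trans (congrArg _ (Subtype.ext ?_))
  exact map_one (f.app ⦋0⦌).hom

lemma mapN_differentialN (f : C ⟶ C') (x : Normalization C) :
    mapN f (differentialN C x) = differentialN C' (mapN f x) := by
  induction x using DirectSum.induction_on with
  | zero => simp only [map_zero]
  | add a b ha hb => simp only [map_add, ha, hb]
  | of p b =>
    rw [differentialN_of, mapN_of, mapN_of, differentialN_of]
    congr 1
    apply Subtype.ext
    change (f.app ⦋p + 1⦌).hom (coboundary b.1) = coboundary ((f.app ⦋p⦌).hom b.1)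
    rw [coboundary_eq, coboundary_eq, map_sum]
    exact Finset.sum_congr rfl fun k _ => by rw [map_zsmul, app_map]

lemma mapN_mem (f : C ⟶ C') {n : ℤ} {x : Normalization C} (hx : x ∈ degN C n) : mapN f x ∈ degN C' n := by
  rcases degN_cases hx with rfl | ⟨p, x, rfl, rfl⟩
  · rw [map_zero]; exact zero_mem _
  · rw [mapN_of]; exact of_mem_degN _

end CosimplicialRing

/-- A DG ring: a unital associative ring `A = ⨁ i : ℤ, A^i`, graded by the additive subgroups
`deg i = A^i`, with a differential `d` of degree `1` which satisfies `d ∘ d = 0` and the graded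
Leibniz rule `d (a b) = d a ⬝ b + (-1)^i a ⬝ d b` for `a ∈ A^i`. It suffices to take `b` arbitrary,
since the rule is additive in `b`. -/
structure DGRing where
  carrier : Type u
  [ring : Ring carrier]
  deg : ℤ → Submodule ℤ carrier
  [graded : GradedAlgebra deg]
  d : carrier →+ carrier
  d_mem : ∀ {i : ℤ} {a : carrier}, a ∈ deg i → d a ∈ deg (i + 1)
  d_d : ∀ a : carrier, d (d a) = 0
  leibniz : ∀ {i : ℤ} {a : carrier}, a ∈ deg i → ∀ b : carrier,
    d (a * b) = d a * b + i.negOnePow • (a * d b)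


namespace DGRing
attribute [instance] DGRing.ring DGRing.graded

section Tensor

open TensorProduct DirectSum

lemma zsmul_balanced {M N P : Type*} [AddCommGroup M] [AddCommGroup N] [AddCommGroup P]
    (F : M →+ N →+ P) (r : ℤ) (m : M) (n : N) : F (r • m) n = F m (r • n) := by
  rw [map_zsmul, map_zsmul, AddMonoidHom.zsmul_apply]

/-- A homomorphism of DG rings: a unital ring homomorphism which preserves degrees and commutes
with the differentials. -/
structure Hom (A : DGRing.{u}) (B : DGRing.{v}) where
  toRingHom : A.carrier →+* B.carrier
  map_deg : ∀ {i : ℤ} {a : A.carrier}, a ∈ A.deg i → toRingHom a ∈ B.deg i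
  map_d : ∀ a : A.carrier, toRingHom (A.d a) = B.d (toRingHom a)

variable (A : DGRing.{u}) (B : DGRing.{v})

lemma induction_deg {P : A.carrier → Prop} (h0 : P 0)
    (hadd : ∀ a b, P a → P b → P (a + b)) (h : ∀ (i : ℤ) (a : A.carrier), a ∈ A.deg i → P a)
    (a : A.carrier) : P a :=
  DirectSum.Decomposition.inductionOn A.deg h0 (fun {i} m => h i m m.2) hadd a

/-- The underlying ring of the tensor product `A ⊗ B` over `ℤ` of DG rings, with Koszul signs in
the product: `(a₁ ⊗ b₁) (a₂ ⊗ b₂) = (-1)^{j k} a₁ a₂ ⊗ b₁ b₂` for `b₁` of degree `j` and `a₂` of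
degree `k`. -/
def TensorCarrier : Type (max u v) := A.deg ᵍ⊗[ℤ] B.deg

instance : Ring (TensorCarrier A B) := inferInstanceAs (Ring (A.deg ᵍ⊗[ℤ] B.deg))

variable {A B} in
/-- The pure tensor `a ⊗ b`. -/
def tm (a : A.carrier) (b : B.carrier) : TensorCarrier A B := GradedTensorProduct.tmul ℤ a b

/-- The biadditive map `(a, b) ↦ a ⊗ b`. -/
def tmulHom : A.carrier →+ B.carrier →+ TensorCarrier A B :=
  AddMonoidHom.mk' (fun a => AddMonoidHom.mk' (fun b => tm a b)
      fun b b' => TensorProduct.tmul_add a b b')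
    fun a a' => AddMonoidHom.ext fun b =>
      TensorProduct.add_tmul a a' b

variable {A B}

lemma zsmul_tmul (c : ℤ) (a : A.carrier) (b : B.carrier) :
    (tm (c • a) b : TensorCarrier A B) = c • (tm a b) :=
  map_zsmul ((tmulHom A B).flip b) c a

lemma tmul_zsmul (c : ℤ) (a : A.carrier) (b : B.carrier) :
    (tm a (c • b) : TensorCarrier A B) = c • (tm a b) :=
  map_zsmul (tmulHom A B a) c b

lemma add_tmul' (a a' : A.carrier) (b : B.carrier) :
    (tm (a + a') b : TensorCarrier A B) = tm a b + tm a' b :=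
  map_add ((tmulHom A B).flip b) a a'

lemma tmul_add' (a : A.carrier) (b b' : B.carrier) :
    (tm a (b + b') : TensorCarrier A B) = tm a b + tm a b' :=
  map_add (tmulHom A B a) b b'

lemma zero_tmul' (b : B.carrier) : (tm (0 : A.carrier) b : TensorCarrier A B) = 0 :=
  map_zero ((tmulHom A B).flip b)

lemma tmul_zero' (a : A.carrier) : (tm a (0 : B.carrier) : TensorCarrier A B) = 0 :=
  map_zero (tmulHom A B a)

variable (A B)

/-- The piece of degree `n` of `A ⊗ B`, generated by the `a ⊗ b` with `a ∈ A^i`, `b ∈ B^j` and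
`i + j = n`. -/
def tensorDeg (n : ℤ) : Submodule ℤ (TensorCarrier A B) :=
  AddSubgroup.toIntSubmodule (AddSubgroup.closure
    {x | ∃ i j : ℤ, i + j = n ∧ ∃ a ∈ A.deg i, ∃ b ∈ B.deg j, x = tm a b})

variable {A B}

lemma tmul_mem {i j n : ℤ} (h : i + j = n) {a : A.carrier} (ha : a ∈ A.deg i) {b : B.carrier}
    (hb : b ∈ B.deg j) : (tm a b : TensorCarrier A B) ∈ tensorDeg A B n :=
  AddSubgroup.subset_closure ⟨i, j, h, a, ha, b, hb, rfl⟩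

lemma tmul_mul_tmul {j k : ℤ} (a₁ : A.carrier) {b₁ : B.carrier} (hb₁ : b₁ ∈ B.deg j)
    {a₂ : A.carrier} (ha₂ : a₂ ∈ A.deg k) (b₂ : B.carrier) :
    (tm a₁ b₁ * tm a₂ b₂ : TensorCarrier A B) =
      ((j * k).negOnePow : ℤ) • tm (a₁ * a₂) (b₁ * b₂) :=
  GradedTensorProduct.tmul_coe_mul_coe_tmul A.deg B.deg a₁ ⟨b₁, hb₁⟩ ⟨a₂, ha₂⟩ b₂

lemma tensor_induction {P : TensorCarrier A B → Prop} (h0 : P 0)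
    (hadd : ∀ x y, P x → P y → P (x + y))
    (h : ∀ (i j : ℤ) (a : A.carrier) (b : B.carrier), a ∈ A.deg i → b ∈ B.deg j →
      P (tm a b)) (x : TensorCarrier A B) : P x := by
  refine TensorProduct.induction_on (motive := fun y : A.carrier ⊗[ℤ] B.carrier => P y)
    x h0 (fun a b => ?_) (fun y z hy hz => hadd _ _ hy hz)
  change P (tm a b)
  induction a using A.induction_deg with
  | h0 => rw [zero_tmul']; exact h0
  | hadd a a' ha ha' => rw [add_tmul']; exact hadd _ _ ha ha'
  | h i a ha =>
    induction b using B.induction_deg with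
    | h0 => rw [tmul_zero']; exact h0
    | hadd b b' hb hb' => rw [tmul_add']; exact hadd _ _ hb hb'
    | h j b hb => exact h i j a b ha hb

lemma tensorDeg_induction {n : ℤ} {P : ∀ x : TensorCarrier A B, x ∈ tensorDeg A B n → Prop}
    (h0 : P 0 (zero_mem _))
    (hadd : ∀ x y hx hy, P x hx → P y hy → P (x + y) (add_mem hx hy))
    (hneg : ∀ x hx, P x hx → P (-x) (neg_mem hx))
    (h : ∀ (i j : ℤ) (a : A.carrier) (b : B.carrier) (hn : i + j = n) (ha : a ∈ A.deg i)
      (hb : b ∈ B.deg j), P (tm a b) (tmul_mem hn ha hb)) {x : TensorCarrier A B}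
    (hx : x ∈ tensorDeg A B n) : P x hx := by
  refine AddSubgroup.closure_induction (p := P) ?_ h0 hadd hneg hx
  rintro _ ⟨i, j, hn, a, ha, b, hb, rfl⟩
  exact h i j a b hn ha hb

lemma one_mem_tensorDeg : (1 : TensorCarrier A B) ∈ tensorDeg A B 0 :=
  tmul_mem (add_zero 0) SetLike.GradedOne.one_mem SetLike.GradedOne.one_mem

lemma mul_mem_tensorDeg {m n : ℤ} {x y : TensorCarrier A B} (hx : x ∈ tensorDeg A B m)
    (hy : y ∈ tensorDeg A B n) : x * y ∈ tensorDeg A B (m + n) := by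
  induction hx using tensorDeg_induction with
  | h0 => rw [zero_mul]; exact zero_mem _
  | hadd x x' _ _ hx hx' => rw [add_mul]; exact add_mem hx hx'
  | hneg x _ hx => rw [neg_mul]; exact neg_mem hx
  | h i j a₁ b₁ hij ha₁ hb₁ =>
    induction hy using tensorDeg_induction with
    | h0 => rw [mul_zero]; exact zero_mem _
    | hadd x x' _ _ hx hx' => rw [mul_add]; exact add_mem hx hx'
    | hneg x _ hx => rw [mul_neg]; exact neg_mem hx
    | h k l a₂ b₂ hkl ha₂ hb₂ =>
      rw [tmul_mul_tmul a₁ hb₁ ha₂ b₂]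
      exact Submodule.smul_mem _ _ (tmul_mem (show (i + k) + (j + l) = m + n by omega)
        (SetLike.GradedMul.mul_mem ha₁ ha₂) (SetLike.GradedMul.mul_mem hb₁ hb₂))

variable (A B)

/-- The pairing `A^i × B^j → (A ⊗ B)^{i+j}`. -/
def tensorPiece (i j : ℤ) : A.deg i →+ B.deg j →+ tensorDeg A B (i + j) :=
  AddMonoidHom.mk' (fun a => AddMonoidHom.mk'
      (fun b => ⟨tm (a : A.carrier) (b : B.carrier), tmul_mem rfl a.2 b.2⟩)
      fun _ _ => Subtype.ext (tmul_add' _ _ _))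
    fun _ _ => AddMonoidHom.ext fun _ => Subtype.ext (add_tmul' _ _ _)

/-- The pairing of the decompositions of `A` and `B` into homogeneous components. -/
def tensorDecomposeAux : (⨁ i, A.deg i) →+ (⨁ j, B.deg j) →+ ⨁ n : ℤ, tensorDeg A B n :=
  DirectSum.toAddMonoid fun i => (DirectSum.toAddMonoid fun j =>
    ((DirectSum.of (fun n => tensorDeg A B n) (i + j)).compHom.comp (tensorPiece A B i j)).flip).flip

/-- The decomposition of an element of `A ⊗ B` into homogeneous components. -/
def tensorDecompose : TensorCarrier A B →+ ⨁ n : ℤ, tensorDeg A B n :=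
  TensorProduct.liftAddHom
    (((tensorDecomposeAux A B).comp (DirectSum.decomposeAddEquiv A.deg).toAddMonoidHom).compl₂
      (DirectSum.decomposeAddEquiv B.deg).toAddMonoidHom)
    fun r a b => zsmul_balanced _ r a b

variable {A B}

lemma tensorDecompose_tmul {i j n : ℤ} (h : i + j = n) {a : A.carrier} (ha : a ∈ A.deg i)
    {b : B.carrier} (hb : b ∈ B.deg j) :
    tensorDecompose A B (tm a b) =
      DirectSum.of (fun n => tensorDeg A B n) n ⟨tm a b, tmul_mem h ha hb⟩ := by
  subst h
  change tensorDecomposeAux A B (decompose A.deg a) (decompose B.deg b) = _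
  rw [DirectSum.decompose_of_mem _ ha, DirectSum.decompose_of_mem _ hb, tensorDecomposeAux,
    DirectSum.toAddMonoid_of, AddMonoidHom.flip_apply, DirectSum.toAddMonoid_of]
  rfl

lemma coe_tensorDecompose (x : TensorCarrier A B) :
    DirectSum.coeAddMonoidHom (tensorDeg A B) (tensorDecompose A B x) = x := by
  induction x using tensor_induction with
  | h0 => rw [map_zero, map_zero]
  | hadd b c hb hc => rw [map_add, map_add, hb, hc]
  | h i j a b ha hb =>
    rw [tensorDecompose_tmul rfl ha hb, DirectSum.coeAddMonoidHom_of]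

lemma tensorDecompose_of_mem {n : ℤ} {x : TensorCarrier A B} (hx : x ∈ tensorDeg A B n) :
    tensorDecompose A B x = DirectSum.of (fun n => tensorDeg A B n) n ⟨x, hx⟩ := by
  induction hx using tensorDeg_induction with
  | h0 => exact (map_zero _).trans (map_zero _).symm
  | hadd x y hx hy ex ey => rw [map_add, ex, ey, ← map_add]; rfl
  | hneg x hx ex => rw [map_neg, ex, ← map_neg]; rfl
  | h i j a b hn ha hb => exact tensorDecompose_tmul hn ha hb

lemma tensorDecompose_coe (x : ⨁ n : ℤ, tensorDeg A B n) :
    tensorDecompose A B (DirectSum.coeAddMonoidHom (tensorDeg A B) x) = x := by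
  induction x using DirectSum.induction_on with
  | zero => rw [map_zero, map_zero]
  | add b c hb hc => rw [map_add, map_add, hb, hc]
  | of n y => rw [DirectSum.coeAddMonoidHom_of, tensorDecompose_of_mem y.2]

instance : GradedAlgebra (tensorDeg A B) where
  one_mem := one_mem_tensorDeg
  mul_mem _ _ _ _ hx hy := mul_mem_tensorDeg hx hy
  decompose' := tensorDecompose A B
  left_inv := coe_tensorDecompose
  right_inv := tensorDecompose_coe

variable (A) in
/-- The operator which multiplies `a ∈ A^i` by `(-1)^i`. -/
def sign : A.carrier →+ A.carrier :=
  (DirectSum.toAddMonoid fun i => (i.negOnePow : ℤ) • (A.deg i).subtype.toAddMonoidHom).comp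
    (DirectSum.decomposeAddEquiv A.deg).toAddMonoidHom

lemma sign_apply {i : ℤ} {a : A.carrier} (ha : a ∈ A.deg i) :
    A.sign a = (i.negOnePow : ℤ) • a := by
  change DirectSum.toAddMonoid _ (decompose A.deg a) = _
  rw [DirectSum.decompose_of_mem _ ha, DirectSum.toAddMonoid_of]
  rfl

variable (A B) in
/-- The differential `d (a ⊗ b) = d a ⊗ b + (-1)^i a ⊗ d b`, for `a ∈ A^i`. -/
def tensorD : TensorCarrier A B →+ TensorCarrier A B :=
  TensorProduct.liftAddHom
    ((tmulHom A B).comp A.d + ((tmulHom A B).comp A.sign).compl₂ B.d)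
    fun r a b => zsmul_balanced _ r a b

lemma tensorD_tmul {i : ℤ} {a : A.carrier} (ha : a ∈ A.deg i) (b : B.carrier) :
    tensorD A B (tm a b) =
      tm (A.d a) b + (i.negOnePow : ℤ) • (tm a (B.d b)) := by
  change tm (A.d a) b + tm (A.sign a) (B.d b) = _
  rw [sign_apply ha, zsmul_tmul]

lemma tensorD_mem {n : ℤ} {x : TensorCarrier A B} (hx : x ∈ tensorDeg A B n) :
    tensorD A B x ∈ tensorDeg A B (n + 1) := by
  induction hx using tensorDeg_induction with
  | h0 => rw [map_zero]; exact zero_mem _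
  | hadd x x' _ _ hx hx' => rw [map_add]; exact add_mem hx hx'
  | hneg x _ hx => rw [map_neg]; exact neg_mem hx
  | h i j a b hij ha hb =>
    rw [tensorD_tmul ha]
    exact add_mem (tmul_mem (by omega) (A.d_mem ha) hb)
      (zsmul_mem (tmul_mem (by omega) ha (B.d_mem hb)) _)

lemma tensorD_tensorD (x : TensorCarrier A B) : tensorD A B (tensorD A B x) = 0 := by
  induction x using tensor_induction with
  | h0 => rw [map_zero, map_zero]
  | hadd b c hb hc => rw [map_add, map_add, hb, hc, add_zero]
  | h i j a b ha hb =>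
    rw [tensorD_tmul ha, map_add, map_zsmul, tensorD_tmul (A.d_mem ha), tensorD_tmul ha, A.d_d,
      B.d_d, Int.negOnePow_succ, zero_tmul', tmul_zero', Units.val_neg, neg_smul, smul_zero,
      add_zero, zero_add, neg_add_cancel]

lemma tensorD_mul {n : ℤ} {x : TensorCarrier A B} (hx : x ∈ tensorDeg A B n)
    (y : TensorCarrier A B) :
    tensorD A B (x * y) = tensorD A B x * y + n.negOnePow • (x * tensorD A B y) := by
  rw [Units.smul_def]
  induction hx using tensorDeg_induction with
  | h0 => rw [zero_mul, zero_mul, map_zero, zero_mul, smul_zero, add_zero]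
  | hadd x x' _ _ hx hx' =>
    rw [add_mul, map_add, map_add, hx, hx', add_mul, add_mul, smul_add]; abel
  | hneg x _ hx => rw [neg_mul, neg_mul, map_neg, map_neg, hx, neg_mul, smul_neg]; abel
  | h i j a₁ b₁ hij ha₁ hb₁ =>
    subst hij
    induction y using tensor_induction with
    | h0 => rw [mul_zero, mul_zero, map_zero, mul_zero, smul_zero, add_zero]
    | hadd x x' hx hx' =>
      rw [mul_add, map_add, map_add, hx, hx', mul_add, mul_add, smul_add]; abel
    | h k l a₂ b₂ ha₂ hb₂ =>
      rw [tmul_mul_tmul a₁ hb₁ ha₂ b₂, map_zsmul,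
        tensorD_tmul (SetLike.GradedMul.mul_mem ha₁ ha₂), A.leibniz ha₁, B.leibniz hb₁,
        tensorD_tmul ha₁, tensorD_tmul ha₂, add_mul, mul_add, smul_mul_assoc, mul_smul_comm,
        tmul_mul_tmul _ hb₁ ha₂, tmul_mul_tmul _ (B.d_mem hb₁) ha₂,
        tmul_mul_tmul _ hb₁ (A.d_mem ha₂), tmul_mul_tmul _ hb₁ ha₂]
      have hJ : (j.negOnePow : ℤ) * (j.negOnePow : ℤ) = 1 := by
        rw [← Units.val_mul, Int.units_mul_self, Units.val_one]
      rw [mul_add j k 1, add_mul j 1 k, mul_one, one_mul]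
      simp only [Int.negOnePow_add, Units.val_mul, Units.smul_def, add_tmul', tmul_add', smul_add,
        zsmul_tmul, tmul_zsmul]
      have e : ((i.negOnePow : ℤ) * j.negOnePow) * ((j * k).negOnePow * j.negOnePow) =
          (j * k).negOnePow * i.negOnePow := by
        linear_combination ((j * k).negOnePow * i.negOnePow : ℤ) * hJ
      simp only [smul_smul, e]
      module

end Tensor

/-- The tensor product of two DG rings over `ℤ`. -/
def tensor (A : DGRing.{u}) (B : DGRing.{v}) : DGRing.{max u v} where
  carrier := TensorCarrier A B
  deg := tensorDeg A B
  d := tensorD A B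
  d_mem := tensorD_mem
  d_d := tensorD_tensorD
  leibniz := tensorD_mul


section TensorMap

open TensorProduct

variable {A : DGRing.{u}} {A' : DGRing.{v}} {B : DGRing.{w}} {B' : DGRing.{x}}

/-- The additive map `a ⊗ b ↦ f a ⊗ g b`. -/
def tensorMapAdd (f : Hom A A') (g : Hom B B') : TensorCarrier A B →+ TensorCarrier A' B' :=
  TensorProduct.liftAddHom
    (((tmulHom A' B').comp f.toRingHom.toAddMonoidHom).compl₂ g.toRingHom.toAddMonoidHom)
    fun r a b => zsmul_balanced _ r a b

lemma tensorMapAdd_tmul (f : Hom A A') (g : Hom B B') (a : A.carrier) (b : B.carrier) :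
    tensorMapAdd f g (tm a b) = tm (f.toRingHom a) (g.toRingHom b) := rfl

lemma tensorMapAdd_mul (f : Hom A A') (g : Hom B B') (x y : TensorCarrier A B) :
    tensorMapAdd f g (x * y) = tensorMapAdd f g x * tensorMapAdd f g y := by
  induction x using tensor_induction with
  | h0 => rw [zero_mul, map_zero, zero_mul]
  | hadd x x' hx hx' => rw [add_mul, map_add, map_add, hx, hx', add_mul]
  | h i j a₁ b₁ ha₁ hb₁ =>
    induction y using tensor_induction with
    | h0 => rw [mul_zero, map_zero, mul_zero]
    | hadd x x' hx hx' => rw [mul_add, map_add, map_add, hx, hx', mul_add]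
    | h k l a₂ b₂ ha₂ hb₂ =>
      rw [tmul_mul_tmul a₁ hb₁ ha₂ b₂, map_zsmul, tensorMapAdd_tmul, tensorMapAdd_tmul,
        tensorMapAdd_tmul, tmul_mul_tmul _ (g.map_deg hb₁) (f.map_deg ha₂), map_mul, map_mul]

/-- The DG ring homomorphism `f ⊗ g`. -/
def tensorMap (f : Hom A A') (g : Hom B B') : Hom (tensor A B) (tensor A' B') where
  toRingHom :=
    { toFun := tensorMapAdd f g
      map_one' := by
        change tm (f.toRingHom 1) (g.toRingHom 1) = tm 1 1
        rw [map_one, map_one]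
      map_mul' := tensorMapAdd_mul f g
      map_zero' := map_zero (tensorMapAdd f g)
      map_add' := map_add (tensorMapAdd f g) }
  map_deg {i x} hx := by
    change tensorMapAdd f g x ∈ tensorDeg A' B' i
    induction hx using tensorDeg_induction with
    | h0 => rw [map_zero]; exact zero_mem _
    | hadd x x' _ _ hx hx' => rw [map_add]; exact add_mem hx hx'
    | hneg x _ hx => rw [map_neg]; exact neg_mem hx
    | h i j a b hij ha hb => exact tmul_mem hij (f.map_deg ha) (g.map_deg hb)
  map_d x := by
    change tensorMapAdd f g (tensorD A B x) = tensorD A' B' (tensorMapAdd f g x)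
    induction x using tensor_induction with
    | h0 => simp only [map_zero]
    | hadd x x' hx hx' => simp only [map_add, hx, hx']
    | h i j a b ha hb =>
      rw [tensorD_tmul ha, tensorMapAdd_tmul, tensorD_tmul (f.map_deg ha), map_add, map_zsmul,
        tensorMapAdd_tmul, tensorMapAdd_tmul, f.map_d, g.map_d]

end TensorMap

/-- The identity homomorphism. -/
def Hom.id (B : DGRing.{u}) : Hom B B where
  toRingHom := RingHom.id B.carrier
  map_deg ha := ha
  map_d _ := rfl

/-- The underlying cochain complex of abelian groups of a DG ring, with `A^i` in degree `i`. -/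
def toComplex (A : DGRing.{u}) : CochainComplex AddCommGrpCat.{u} ℤ where
  X i := AddCommGrpCat.of (A.deg i)
  d i j :=
    if h : i + 1 = j then
      AddCommGrpCat.ofHom
        ((A.d.comp (A.deg i).subtype.toAddMonoidHom).codRestrict (A.deg j)
          fun a => h ▸ A.d_mem a.2)
    else 0
  shape i j h := dif_neg h
  d_comp_d' i j k hij hjk := by
    have hij : i + 1 = j := hij
    have hjk : j + 1 = k := hjk
    rw [dif_pos hij, dif_pos hjk]
    ext a
    exact A.d_d a.1

/-- The map of underlying cochain complexes given by a DG ring homomorphism. -/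
def Hom.toComplexMap {A B : DGRing.{u}} (f : Hom A B) : A.toComplex ⟶ B.toComplex where
  f i := AddCommGrpCat.ofHom
    ((f.toRingHom.toAddMonoidHom.comp (A.deg i).subtype.toAddMonoidHom).codRestrict (B.deg i)
      fun a => f.map_deg a.2)
  comm' i j hij := by
    have hij : i + 1 = j := hij
    dsimp only [toComplex]
    rw [dif_pos hij, dif_pos hij]
    ext a
    exact (f.map_d a.1).symm

open CosimplicialRing in
/-- The normalization of a cosimplicial ring, as a DG ring. -/
def normalization (C : CosimplicialObject RingCat.{u}) : DGRing.{u} where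
  carrier := Normalization C
  deg := degN C
  d := differentialN C
  d_mem := differentialN_mem
  d_d := differentialN_differentialN
  leibniz := differentialN_mul

open CosimplicialRing in
/-- Functoriality of the normalization. -/
def normalizationMap {C C' : CosimplicialObject RingCat.{u}} (f : C ⟶ C') :
    Hom (normalization C) (normalization C') where
  toRingHom :=
    { toFun := mapN f
      map_one' := mapN_one f
      map_mul' := mapN_mul f
      map_zero' := map_zero (mapN f)
      map_add' := map_add (mapN f) }
  map_deg := mapN_mem f
  map_d := mapN_differentialN f

/-- The cosimplicial ring `p ↦ Hom(X_p, ℤ)` (functions with pointwise operations) of a simplicial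
set `X`. -/
def cochainRing (X : SSet.{u}) : CosimplicialObject RingCat.{u} where
  obj a := RingCat.of (X.obj (Opposite.op a) → ℤ)
  map φ := RingCat.ofHom
    (RingHom.pi fun x => Pi.evalRingHom (fun _ => ℤ) (X.map φ.op x))
  map_id a := by
    ext f x
    change f (X.map (𝟙 _) x) = f x
    rw [X.map_id]; rfl
  map_comp φ ψ := by
    ext f x
    change f (X.map (ψ.op ≫ φ.op) x) = f (X.map φ.op (X.map ψ.op x))
    rw [X.map_comp]; rfl

/-- Restriction of functions along a map of simplicial sets. -/
def cochainRingMap {X Y : SSet.{u}} (f : X ⟶ Y) : cochainRing Y ⟶ cochainRing X where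
  app a := RingCat.ofHom
    (RingHom.pi fun x => Pi.evalRingHom (fun _ => ℤ) (f.app (Opposite.op a) x))
  naturality a b φ := by
    refine RingCat.hom_ext (RingHom.ext fun g => funext fun x => ?_)
    change g (Y.map φ.op (f.app _ x)) = g (f.app _ (X.map φ.op x))
    exact congrArg g (ConcreteCategory.congr_hom (f.naturality φ.op) x).symm

/-- The DG ring `N(X, B) = N(X, ℤ) ⊗ B`, where `N(X, ℤ)` is the normalization of the cosimplicial
ring `p ↦ Hom(X_p, ℤ)`. -/
def ofSSet (X : SSet.{u}) (B : DGRing.{v}) : DGRing.{max u v} :=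
  tensor (normalization (cochainRing X)) B

/-- The DG ring homomorphism `N(Y, B) → N(X, B)` induced by a map `f : X ⟶ Y` of simplicial sets,
which sends `φ ⊗ b` to `(φ ∘ f) ⊗ b`. -/
def ofSSetMap {X Y : SSet.{u}} (f : X ⟶ Y) (B : DGRing.{v}) : Hom (ofSSet Y B) (ofSSet X B) :=
  tensorMap (normalizationMap (cochainRingMap f)) (Hom.id B)

end DGRing

end

/-! Write q = n + 1. A normalized cochain on the simplex is determined by its values on
nondegenerate simplices, and the only nondegenerate simplices outside the horn are the top simplex
and its i-th face. The kernel K of restriction to the horn is therefore ℤ in degrees n and n + 1 and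
zero elsewhere. Its differential sends the indicator of the face to (-1)^i times the indicator of
the top simplex, which is an isomorphism, so K is contractible. Restriction is surjective because
normalized cochains extend by zero, and this extension is an additive section, though not a chain
map.

To pass to coefficients in an arbitrary B without any flatness hypothesis, this is recorded as
explicit data, a `Hom.Contraction`: the section s together with an operator h that contracts the
kernel. Such data consist of additive maps and identities between them, so applying them to the left
tensor factor gives a contraction of f ⊗ 1 (`Hom.Contraction.tensor`). The contraction identity is
imposed on elements a - s (f a) rather than on elements of ker f: these are the same elements, but
the first form is additive in a and so can be checked on pure tensors, with no description of the
kernel of f ⊗ 1.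

A contraction makes f surjective and a homotopy equivalence of complexes
(`Hom.Contraction.quasiIso`). The section s is corrected to a chain map by composing it with the
projector 1 - (d h + h d), which is a chain map vanishing on ker f. The geometric input is
`differentialN_hornHomotopy`, packaged in `hornContraction`. -/

noncomputable section

open CategoryTheory Simplicial

namespace DGRing

/-- A contraction of a homomorphism `f : A → A'` of DG rings: a degreewise additive section `s`
of `f`, and an operator `h` of degree `-1` on `A` with values in the kernel of `f` such that
`d h + h d` is the identity on the image of `1 - s f`, that is on the kernel of `f`. -/
structure Hom.Contraction {A : DGRing.{u}} {A' : DGRing.{v}} (f : Hom A A') where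
  /-- The additive section of `f`. -/
  s : A'.carrier →+ A.carrier
  s_mem : ∀ {i : ℤ} {a : A'.carrier}, a ∈ A'.deg i → s a ∈ A.deg i
  map_s : ∀ a : A'.carrier, f.toRingHom (s a) = a
  /-- The contracting homotopy of the kernel of `f`. -/
  h : A.carrier →+ A.carrier
  h_mem : ∀ {i j : ℤ} {a : A.carrier}, i + 1 = j → a ∈ A.deg j → h a ∈ A.deg i
  map_h : ∀ a : A.carrier, f.toRingHom (h a) = 0
  d_h_add_h_d : ∀ a : A.carrier,
    A.d (h (a - s (f.toRingHom a))) + h (A.d (a - s (f.toRingHom a))) = a - s (f.toRingHom a)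

namespace Hom.Contraction

/-! ### A contraction yields a homotopy equivalence -/

section QuasiIso

variable {A A' : DGRing.{u}} {f : Hom A A'} (c : f.Contraction)

include c in
lemma surjective : Function.Surjective f.toRingHom := fun a => ⟨c.s a, c.map_s a⟩

lemma d_h_add_h_d_of_map_eq_zero {a : A.carrier} (ha : f.toRingHom a = 0) :
    A.d (c.h a) + c.h (A.d a) = a := by
  simpa only [ha, map_zero, sub_zero] using c.d_h_add_h_d a

/-- The projector `1 - (d h + h d)`. -/
def proj : A.carrier →+ A.carrier :=
  AddMonoidHom.id _ - (A.d.comp c.h + c.h.comp A.d)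

lemma proj_apply (a : A.carrier) : c.proj a = a - (A.d (c.h a) + c.h (A.d a)) := rfl

lemma proj_mem {i : ℤ} {a : A.carrier} (ha : a ∈ A.deg i) : c.proj a ∈ A.deg i := by
  refine sub_mem ha (add_mem ?_ (c.h_mem rfl (A.d_mem ha)))
  have := A.d_mem (c.h_mem (sub_add_cancel i 1) ha)
  rwa [sub_add_cancel] at this

/-- Since d d = 0, both sides reduce to d a - d h d a. -/
lemma proj_d (a : A.carrier) : c.proj (A.d a) = A.d (c.proj a) := by
  simp only [proj_apply, A.d_d, map_zero, map_sub, map_add, add_zero, zero_add]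

lemma map_proj (a : A.carrier) : f.toRingHom (c.proj a) = f.toRingHom a := by
  rw [proj_apply, map_sub, map_add, f.map_d, c.map_h, c.map_h, map_zero, add_zero, sub_zero]

/-- The projector vanishes on the kernel of `f`, where d h + h d is the identity, so it depends only
on the image under `f`. This is what turns the non-chain map `s` into a chain map and makes the
choice of section irrelevant. -/
lemma proj_eq_of_map_eq {a b : A.carrier} (h : f.toRingHom a = f.toRingHom b) :
    c.proj a = c.proj b := by
  rw [← sub_eq_zero, ← map_sub, proj_apply,
    c.d_h_add_h_d_of_map_eq_zero (by rw [map_sub, h, sub_self]), sub_self]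

/-- The homotopy inverse of `f` on the underlying complexes. -/
def invMap : A'.toComplex ⟶ A.toComplex where
  f i := AddCommGrpCat.ofHom
    (((c.proj.comp c.s).comp (A'.deg i).subtype.toAddMonoidHom).codRestrict (A.deg i)
      fun a => c.proj_mem (c.s_mem a.2))
  comm' i j hij := by
    have hij : i + 1 = j := hij
    dsimp only [toComplex]
    rw [dif_pos hij, dif_pos hij]
    ext a
    change A.d (c.proj (c.s a.1)) = c.proj (c.s (A'.d a.1))
    -- The elements d (s a) and s (d a) may differ, but both have image d a under `f`, so the
    -- projector identifies them.
    rw [← c.proj_d]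
    refine c.proj_eq_of_map_eq ?_
    rw [f.map_d, c.map_s, c.map_s]

lemma toComplex_d_apply {i j : ℤ} (hij : i + 1 = j) (a : A.deg i) :
    ((A.toComplex.d i j).hom a : A.deg j).1 = A.d a.1 := by
  dsimp only [toComplex]
  rw [dif_pos hij]
  rfl

/-- The components of `h` on the underlying complex. -/
def hPiece (i j : ℤ) : A.toComplex.X i ⟶ A.toComplex.X j :=
  if hji : j + 1 = i then
    AddCommGrpCat.ofHom
      ((c.h.comp (A.deg i).subtype.toAddMonoidHom).codRestrict (A.deg j)
        fun a => c.h_mem hji a.2)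
  else 0

lemma hPiece_apply {i j : ℤ} (hji : j + 1 = i) (a : A.deg i) :
    ((c.hPiece i j).hom a : A.deg j).1 = c.h a.1 :=
  congrArg (fun g : A.toComplex.X i ⟶ A.toComplex.X j => (g.hom a : A.deg j).1) (dif_pos hji)

/-- The homotopy given by `h` on the underlying complex. -/
def homotopy : Homotopy (𝟙 A.toComplex) (f.toComplexMap ≫ c.invMap) where
  hom := c.hPiece
  zero i j hij := dif_neg hij
  comm i := by
    have h₁ : (ComplexShape.up ℤ).Rel i (i + 1) := rfl
    have h₂ : (ComplexShape.up ℤ).Rel (i - 1) i := sub_add_cancel i 1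
    rw [dNext_eq _ h₁, prevD_eq _ h₂]
    refine AddCommGrpCat.hom_ext (AddMonoidHom.ext fun (a : A.deg i) => Subtype.ext ?_)
    have e₁ : ((c.hPiece (i + 1) i).hom ((A.toComplex.d i (i + 1)).hom a) : A.deg i).1 =
        c.h (A.d a.1) :=
      (c.hPiece_apply rfl _).trans (congrArg c.h (toComplex_d_apply rfl a))
    have e₂ : ((A.toComplex.d (i - 1) i).hom ((c.hPiece i (i - 1)).hom a) : A.deg i).1 =
        A.d (c.h a.1) :=
      (toComplex_d_apply h₂ _).trans (congrArg A.d (c.hPiece_apply h₂ a))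
    -- Here s (f a) and a have the same image, so the composite of `f` with its homotopy inverse is
    -- the projector itself, which differs from the identity by d h + h d.
    have e₃ : c.proj (c.s (f.toRingHom a.1)) = a.1 - (A.d (c.h a.1) + c.h (A.d a.1)) :=
      (c.proj_eq_of_map_eq (c.map_s _)).trans (c.proj_apply _)
    refine Eq.trans ?_ (congrArg₂ (· + ·) (congrArg₂ (· + ·) e₁ e₂) e₃).symm
    change a.1 = _
    abel

/-- The homotopy equivalence of underlying complexes given by a contraction. -/
def homotopyEquiv : HomotopyEquiv A.toComplex A'.toComplex where
  hom := f.toComplexMap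
  inv := c.invMap
  homotopyHomInvId := c.homotopy.symm
  -- This composite is strictly the identity: h takes values in the kernel of `f`, so the projector
  -- does not change images.
  homotopyInvHomId := Homotopy.ofEq <| by
    ext i : 1
    refine AddCommGrpCat.hom_ext (AddMonoidHom.ext fun (a : A'.deg i) => Subtype.ext ?_)
    change f.toRingHom (c.proj (c.s a.1)) = a.1
    rw [c.map_proj, c.map_s]

include c in
lemma quasiIso : QuasiIso f.toComplexMap := c.homotopyEquiv.quasiIso_hom

end QuasiIso

/-! ### Contractions are stable under tensoring with a DG ring -/

section Tensor

variable {A : DGRing.{u}} {A' : DGRing.{v}} {f : Hom A A'} (c : f.Contraction) (B : DGRing.{w})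

/-- The additive map `a ⊗ b ↦ φ a ⊗ b`. -/
def tensorRight {A : DGRing.{u}} {A' : DGRing.{v}} (φ : A.carrier →+ A'.carrier) (B : DGRing.{w}) :
    TensorCarrier A B →+ TensorCarrier A' B :=
  TensorProduct.liftAddHom ((tmulHom A' B).comp φ) fun r a b => zsmul_balanced _ r a b

lemma tensorRight_tmul {A : DGRing.{u}} {A' : DGRing.{v}} (φ : A.carrier →+ A'.carrier)
    (B : DGRing.{w}) (a : A.carrier) (b : B.carrier) :
    tensorRight φ B (tm a b) = tm (φ a) b := rfl

/-- The degree shift k is left free so that one lemma serves both the section (k = 0) and the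
homotopy (k = 1). -/
lemma tensorRight_mem {A : DGRing.{u}} {A' : DGRing.{v}} {φ : A.carrier →+ A'.carrier} {k : ℤ}
    (hφ : ∀ {i j : ℤ} {a : A.carrier}, i + k = j → a ∈ A.deg j → φ a ∈ A'.deg i) (B : DGRing.{w})
    {i j : ℤ} (hij : i + k = j) {y : TensorCarrier A B} (hy : y ∈ tensorDeg A B j) :
    tensorRight φ B y ∈ tensorDeg A' B i := by
  induction hy using tensorDeg_induction with
  | h0 => rw [map_zero]; exact zero_mem _
  | hadd y y' _ _ hy hy' => rw [map_add]; exact add_mem hy hy'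
  | hneg y _ hy => rw [map_neg]; exact neg_mem hy
  | h l m a b hlm ha hb =>
    exact tmul_mem (show l - k + m = i by omega) (hφ (sub_add_cancel l k) ha) hb

/-- The terms h a ⊗ d b occur with signs (-1)^(i-1) and (-1)^i and cancel, because h lowers the
degree of the left factor by one. Only the operator d h + h d on that factor remains. -/
lemma tensorD_tensorRight (y : TensorCarrier A B) :
    tensorD A B (tensorRight c.h B y) + tensorRight c.h B (tensorD A B y) =
      tensorRight (A.d.comp c.h + c.h.comp A.d) B y := by
  induction y using tensor_induction with
  | h0 => simp only [map_zero, add_zero]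
  | hadd y y' hy hy' => rw [map_add (tensorRight (_ + _) B), ← hy, ← hy']; simp only [map_add]; abel
  | h i j a b ha hb =>
    rw [tensorRight_tmul, tensorD_tmul (c.h_mem (sub_add_cancel i 1) ha), tensorD_tmul ha, map_add,
      map_zsmul, tensorRight_tmul, tensorRight_tmul, tensorRight_tmul, AddMonoidHom.add_apply,
      add_tmul', AddMonoidHom.comp_apply, AddMonoidHom.comp_apply, Int.negOnePow_sub,
      Int.negOnePow_one, Units.val_mul, Units.val_neg, Units.val_one]
    module

/-- A contraction of `f` induces one of `f ⊗ 1`. -/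
def tensor : (tensorMap f (Hom.id B)).Contraction where
  s := tensorRight c.s B
  s_mem {i y} hy := tensorRight_mem (k := 0)
    (fun hij ha => by obtain rfl := (add_zero _).symm.trans hij; exact c.s_mem ha) B (add_zero i) hy
  map_s y := by
    change tensorMapAdd f (Hom.id B) (tensorRight c.s B y) = y
    induction y using tensor_induction with
    | h0 => rw [map_zero, map_zero]
    | hadd y y' hy hy' => rw [map_add, map_add, hy, hy']
    | h i j a b ha hb => rw [tensorRight_tmul, tensorMapAdd_tmul, c.map_s]; rfl
  h := tensorRight c.h B
  h_mem hij hy := tensorRight_mem c.h_mem B hij hy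
  map_h y := by
    change tensorMapAdd f (Hom.id B) (tensorRight c.h B y) = 0
    induction y using tensor_induction with
    | h0 => rw [map_zero, map_zero]
    | hadd y y' hy hy' => rw [map_add, map_add, hy, hy', add_zero]
    | h i j a b ha hb => rw [tensorRight_tmul, tensorMapAdd_tmul, c.map_h, zero_tmul']
  d_h_add_h_d (y : TensorCarrier A B) := by
    refine (c.tensorD_tensorRight B _).trans ?_
    change tensorRight _ B (y - tensorRight c.s B (tensorMapAdd f (Hom.id B) y)) =
      y - tensorRight c.s B (tensorMapAdd f (Hom.id B) y)
    induction y using tensor_induction with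
    | h0 => simp only [map_zero, sub_zero]
    | hadd y y' hy hy' =>
      simp only [map_add]
      rw [add_sub_add_comm, map_add, hy, hy']
    | h i j a b ha hb =>
      -- For a pure tensor, the projection onto the kernel is again a pure tensor, so the
      -- contraction identity of `c` applies to its left factor.
      have e : (tm a b - tensorRight c.s B (tensorMapAdd f (Hom.id B) (tm a b)) :
          TensorCarrier A B) = tm (a - c.s (f.toRingHom a)) b :=
        (map_sub ((tmulHom A B).flip b) a (c.s (f.toRingHom a))).symm
      rw [e, tensorRight_tmul]
      exact congrArg (tm · b) (c.d_h_add_h_d a)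

end Tensor

end Hom.Contraction


/-! ### Normalized cochains and extension by zero from a subcomplex -/

open CosimplicialRing Opposite

lemma normalized_cochain_map_eq_zero {X : SSet.{u}} {p : ℕ} (y : normalized (cochainRing X) p)
    {m : SimplexCategory} (φ : ⦋p⦌ ⟶ m) (hφ : ¬ Function.Injective φ.toOrderHom)
    (z : X.obj (op m)) : y.1 (X.map φ.op z) = 0 :=
  congrFun (normalized_map_eq_zero y.2 φ hφ) z

/-- A simplex of the standard simplex is the pullback of the identity simplex along its own
structure map, so a non-injective one is degenerate. -/
lemma normalized_stdSimplex_eq_zero {q p : ℕ} (y : normalized (cochainRing Δ[q]) p)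
    (φ : ⦋p⦌ ⟶ ⦋q⦌) (hφ : ¬ Function.Injective φ.toOrderHom) :
    y.1 (SSet.stdSimplex.objEquiv.symm φ) = 0 :=
  (congrArg (fun ψ => y.1 (SSet.stdSimplex.objEquiv.symm ψ)) (Category.comp_id φ).symm).trans <|
    normalized_cochain_map_eq_zero y φ hφ (SSet.stdSimplex.objEquiv.symm (𝟙 _))

section ExtendByZero

variable {X : SSet.{u}} (Y : X.Subcomplex)

/-- A simplex is a face of any of its degeneracies, and subcomplexes are closed under faces. This is
what keeps extension by zero normalized. -/
lemma mem_of_map_σ_mem {n : ℕ} (i : Fin (n + 1)) {z : X.obj (op ⦋n⦌)}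
    (hz : X.map (SimplexCategory.σ i).op z ∈ Y.obj (op ⦋n + 1⦌)) : z ∈ Y.obj (op ⦋n⦌) := by
  have : X.map (SimplexCategory.δ i.castSucc).op (X.map (SimplexCategory.σ i).op z) ∈
    Y.obj (op ⦋n⦌) := Y.map (SimplexCategory.δ i.castSucc).op hz
  rwa [← ConcreteCategory.comp_apply, ← X.map_comp, ← op_comp, SimplexCategory.δ_comp_σ_self,
    op_id, X.map_id] at this

open Classical in
/-- Extension by zero of a normalized cochain from a subcomplex. -/
def extendByZero (p : ℕ) :
    normalized (cochainRing (Y : SSet.{u})) p →+ normalized (cochainRing X) p where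
  toFun y := ⟨fun z : X.obj (op ⦋p⦌) => if hz : z ∈ Y.obj _ then y.1 ⟨z, hz⟩ else 0, by
    cases p with
    | zero => exact AddSubgroup.mem_top _
    | succ n =>
      refine AddSubgroup.mem_iInf.2 fun i => funext fun z => ?_
      change (if hz : X.map (SimplexCategory.σ i).op z ∈ Y.obj _
        then y.1 ⟨X.map (SimplexCategory.σ i).op z, hz⟩ else 0) = 0
      split_ifs with hz
      · exact congrFun ((AddSubgroup.mem_iInf.1 y.2) i) ⟨z, mem_of_map_σ_mem Y i hz⟩
      · rfl⟩
  map_zero' := Subtype.ext <| funext fun z => by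
    change (if hz : z ∈ Y.obj _ then (0 : ℤ) else 0) = 0
    split_ifs <;> rfl
  map_add' y y' := Subtype.ext <| funext fun z => by
    change (if hz : z ∈ Y.obj _ then y.1 ⟨z, hz⟩ + y'.1 ⟨z, hz⟩ else 0) =
      (if hz : z ∈ Y.obj _ then y.1 ⟨z, hz⟩ else 0) + (if hz : z ∈ Y.obj _ then y'.1 ⟨z, hz⟩ else 0)
    split_ifs <;> simp

lemma normalizedMap_ι_apply {p : ℕ} (y : normalized (cochainRing X) p) {z : X.obj (op ⦋p⦌)}
    (hz : z ∈ Y.obj (op ⦋p⦌)) :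
    (normalizedMap (cochainRingMap Y.ι) p y).1 ⟨z, hz⟩ = y.1 z := rfl

lemma extendByZero_apply {p : ℕ} (y : normalized (cochainRing (Y : SSet.{u})) p)
    {z : X.obj (op ⦋p⦌)} (hz : z ∈ Y.obj (op ⦋p⦌)) : (extendByZero Y p y).1 z = y.1 ⟨z, hz⟩ :=
  dif_pos hz

lemma normalizedMap_extendByZero {p : ℕ} (y : normalized (cochainRing (Y : SSet.{u})) p) :
    normalizedMap (cochainRingMap Y.ι) p (extendByZero Y p y) = y :=
  Subtype.ext <| funext fun z => extendByZero_apply Y y z.2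

/-- Extension by zero of normalized cochains of all degrees. -/
def extendByZeroN :
    Normalization (cochainRing (Y : SSet.{u})) →+ Normalization (cochainRing X) :=
  DirectSum.toAddMonoid fun p =>
    (DirectSum.of (fun p => normalized (cochainRing X) p) p).comp (extendByZero Y p)

lemma extendByZeroN_of {p : ℕ} (y : normalized (cochainRing (Y : SSet.{u})) p) :
    extendByZeroN Y (DirectSum.of (fun p => normalized (cochainRing (Y : SSet.{u})) p) p y) =
      DirectSum.of (fun p => normalized (cochainRing X) p) p (extendByZero Y p y) := by
  rw [extendByZeroN, DirectSum.toAddMonoid_of]; rfl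

lemma extendByZeroN_mem {n : ℤ} {y : Normalization (cochainRing (Y : SSet.{u}))}
    (hy : y ∈ degN _ n) : extendByZeroN Y y ∈ degN (cochainRing X) n := by
  rcases degN_cases hy with rfl | ⟨p, y, rfl, rfl⟩
  · rw [map_zero]; exact zero_mem _
  · rw [extendByZeroN_of]; exact of_mem_degN _

lemma mapN_extendByZeroN (y : Normalization (cochainRing (Y : SSet.{u}))) :
    mapN (cochainRingMap Y.ι) (extendByZeroN Y y) = y := by
  induction y using DirectSum.induction_on with
  | zero => rw [map_zero, map_zero]
  | add a b ha hb => rw [map_add, map_add, ha, hb]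
  | of p y => rw [extendByZeroN_of, mapN_of, normalizedMap_extendByZero]

end ExtendByZero

/-! ### The kernel of restriction to the horn and its contraction -/

section Horn

open SSet.stdSimplex

variable {n : ℕ} (i : Fin (n + 2))

/-- A simplex lies in the horn exactly when it misses some vertex other than `i`, and the j-th face
misses only the vertex j. -/
lemma δ_mem_horn_iff (j : Fin (n + 2)) :
    objEquiv.symm (SimplexCategory.δ j) ∈ (SSet.horn.{u} (n + 1) i).obj (op ⦋n⦌) ↔ j ≠ i := by
  rw [SSet.mem_horn_iff_notMem_range]
  have hr : ∀ k : Fin (n + 2), k ∉ Set.range (objEquiv.{u}.symm (SimplexCategory.δ j) :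
      Δ[n + 1] _⦋n⦌) ↔ k = j := fun k => by
    change k ∉ Set.range j.succAbove ↔ _
    simp
  exact ⟨fun ⟨k, hk, h⟩ => (hr k).1 h ▸ hk, fun h => ⟨j, h, (hr j).2 rfl⟩⟩

open Classical in
/-- The normalized cochain which is the indicator function of the `i`-th face of `Δ[n + 1]`. -/
def faceCochain : normalized (cochainRing Δ[n + 1]) n :=
  ⟨fun z => if z = objEquiv.symm (SimplexCategory.δ i) then 1 else 0,
    mem_normalized fun m φ hm => funext fun z => if_neg fun h => by
      obtain ⟨ψ, rfl⟩ := objEquiv.symm.surjective z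
      have e : φ ≫ ψ = SimplexCategory.δ i := objEquiv.symm.injective h
      -- A coface map is injective, so it cannot factor through a simplex of smaller dimension.
      refine not_injective_of_lt hm φ fun a b hab => ?_
      have : (φ ≫ ψ).toOrderHom a = (φ ≫ ψ).toOrderHom b := congrArg ψ.toOrderHom hab
      rw [e] at this
      exact Fin.succAbove_right_injective this⟩

lemma faceCochain_δ (j : Fin (n + 2)) :
    (faceCochain i).1 (objEquiv.{u}.symm (SimplexCategory.δ j)) = if j = i then 1 else 0 := by
  refine if_congr ⟨fun h => ?_, fun h => by rw [h]⟩ rfl rfl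
  have e : SimplexCategory.δ j = SimplexCategory.δ i := objEquiv.symm.injective h
  refine Fin.succAbove_left_injective (funext fun k => ?_)
  exact congrArg (fun f => f.toOrderHom k) e

/-- The value of a normalized cochain on the nondegenerate simplex of top degree, with the sign
`(-1)^i`. -/
def topEval : Normalization (cochainRing.{u} Δ[n + 1]) →+ ℤ :=
  (-1 : ℤ) ^ (i : ℕ) • DirectSum.toAddMonoid fun p =>
    if h : p = n + 1 then
      ((Pi.evalAddMonoidHom _ (objEquiv.symm (𝟙 ⦋n + 1⦌))).comp
        (normalized (cochainRing Δ[n + 1]) (n + 1)).subtype).comp (h ▸ AddMonoidHom.id _)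
    else 0

lemma topEval_of (y : normalized (cochainRing.{u} Δ[n + 1]) (n + 1)) :
    topEval i (DirectSum.of (fun p => normalized (cochainRing Δ[n + 1]) p) (n + 1) y) =
      (-1 : ℤ) ^ (i : ℕ) * y.1 (objEquiv.symm (𝟙 _)) := by
  rw [topEval, AddMonoidHom.smul_apply, DirectSum.toAddMonoid_of, dif_pos rfl]
  rfl

lemma topEval_of_ne {p : ℕ} (hp : p ≠ n + 1) (y : normalized (cochainRing.{u} Δ[n + 1]) p) :
    topEval i (DirectSum.of (fun p => normalized (cochainRing Δ[n + 1]) p) p y) = 0 := by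
  rw [topEval, AddMonoidHom.smul_apply, DirectSum.toAddMonoid_of, dif_neg hp]
  simp

/-- The operator of degree `-1` contracting the cochains on `Δ[n + 1]` which vanish on the horn. -/
def hornHomotopy :
    Normalization (cochainRing.{u} Δ[n + 1]) →+ Normalization (cochainRing.{u} Δ[n + 1]) :=
  ((zmultiplesHom _) (DirectSum.of (fun p => normalized (cochainRing.{u} Δ[n + 1]) p) n
    (faceCochain i))).comp (topEval i)

lemma hornHomotopy_apply (y : Normalization (cochainRing.{u} Δ[n + 1])) :
    hornHomotopy i y = topEval i y •
      DirectSum.of (fun p => normalized (cochainRing.{u} Δ[n + 1]) p) n (faceCochain i) := rfl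

lemma hornHomotopy_mem {k l : ℤ} (hkl : k + 1 = l)
    {y : Normalization (cochainRing.{u} Δ[n + 1])} (hy : y ∈ degN _ l) :
    hornHomotopy i y ∈ degN (cochainRing.{u} Δ[n + 1]) k := by
  rw [hornHomotopy_apply]
  rcases degN_cases hy with rfl | ⟨p, y, rfl, rfl⟩
  · rw [map_zero, zero_smul]; exact zero_mem _
  · by_cases hp : p = n + 1
    · subst hp
      obtain rfl : k = n := by push_cast at hkl; omega
      exact zsmul_mem (of_mem_degN _) _
    · rw [topEval_of_ne i hp, zero_smul]; exact zero_mem _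

lemma normalizedMap_faceCochain :
    normalizedMap (cochainRingMap (SSet.horn.{u} (n + 1) i).ι) n (faceCochain i) = 0 :=
  Subtype.ext <| funext fun z => if_neg fun h => by
    have hz : objEquiv.symm (SimplexCategory.δ i) ∈ (SSet.horn.{u} (n + 1) i).obj (op ⦋n⦌) :=
      h ▸ z.2
    exact (δ_mem_horn_iff i i).1 hz rfl

lemma mapN_hornHomotopy (y : Normalization (cochainRing.{u} Δ[n + 1])) :
    mapN (cochainRingMap (SSet.horn.{u} (n + 1) i).ι) (hornHomotopy i y) = 0 := by
  rw [hornHomotopy_apply, map_zsmul, mapN_of, normalizedMap_faceCochain, map_zero, smul_zero]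

lemma dN_apply_id (y : normalized (cochainRing.{u} Δ[n + 1]) n) :
    (dN n y).1 (objEquiv.symm (𝟙 _)) =
      ∑ j : Fin (n + 2), (-1 : ℤ) ^ (j : ℕ) * y.1 (objEquiv.symm (SimplexCategory.δ j)) := by
  exact (congrFun (coboundary_apply y.1) _).trans (Finset.sum_apply _ _ _)

/-- Only the i-th term of the alternating sum over faces survives. The sign in `topEval` is there to
cancel this one. -/
lemma dN_faceCochain_apply_id :
    (dN n (faceCochain.{u} i)).1 (objEquiv.symm (𝟙 _)) = (-1 : ℤ) ^ (i : ℕ) := by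
  refine (dN_apply_id _).trans ((Finset.sum_congr rfl fun j _ =>
    congrArg _ (faceCochain_δ i j)).trans ?_)
  simp

/-- A normalized cochain is determined by its values on injective simplices. -/
lemma normalized_stdSimplex_ext {q p : ℕ} {y y' : normalized (cochainRing.{u} Δ[q]) p}
    (h : ∀ φ : ⦋p⦌ ⟶ ⦋q⦌, Function.Injective φ.toOrderHom →
      y.1 (objEquiv.symm φ) = y'.1 (objEquiv.symm φ)) : y = y' :=
  Subtype.ext <| funext fun z => by
    obtain ⟨φ, rfl⟩ := objEquiv.symm.surjective z
    by_cases hφ : Function.Injective φ.toOrderHom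
    · exact h φ hφ
    · exact (normalized_stdSimplex_eq_zero y φ hφ).trans
        (normalized_stdSimplex_eq_zero y' φ hφ).symm

/-- Normalized cochains on `Δ[n + 1]` which vanish on the horn are contracted by
`hornHomotopy`. -/
lemma differentialN_hornHomotopy {p : ℕ} (y : normalized (cochainRing.{u} Δ[n + 1]) p)
    (hy : ∀ z ∈ (SSet.horn.{u} (n + 1) i).obj (op ⦋p⦌), y.1 z = 0) :
    differentialN _ (hornHomotopy i (DirectSum.of _ p y)) +
      hornHomotopy i (differentialN _ (DirectSum.of _ p y)) = DirectSum.of _ p y := by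
  rw [differentialN_of, hornHomotopy_apply, hornHomotopy_apply, map_zsmul, differentialN_of]
  have sq : (-1 : ℤ) ^ (i : ℕ) * (-1 : ℤ) ^ (i : ℕ) = 1 := by
    rw [← mul_pow, neg_one_mul, neg_neg, one_pow]
  rcases lt_trichotomy p n with hp | rfl | hp
  -- Below dimension n the horn contains every simplex.
  · obtain rfl : y = 0 := Subtype.ext <| funext fun z => hy z <| by
      rw [SSet.horn_obj_eq_univ i p]; trivial
    simp only [map_zero, zero_smul, add_zero]
  -- In the degree of the face, h y = 0, and d y takes the value (-1)^i y(δ i) on the top simplex,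
  -- so h (d y) is y(δ i) times the face indicator. This is y, which vanishes on the other faces.
  · rw [topEval_of_ne i (by omega), zero_smul, zero_add, topEval_of, ← map_zsmul]
    congr 1
    have hj : ∀ j ≠ i, y.1 (objEquiv.symm (SimplexCategory.δ j)) = 0 := fun j hj =>
      hy _ ((δ_mem_horn_iff i j).2 hj)
    rw [dN_apply_id, Finset.sum_eq_single i (fun j _ h => by rw [hj j h, mul_zero])
      (fun h => absurd (Finset.mem_univ i) h), ← mul_assoc, sq, one_mul]
    refine normalized_stdSimplex_ext fun φ hφ => ?_
    have : Mono φ := SimplexCategory.mono_iff_injective.2 hφ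
    obtain ⟨j, rfl⟩ := SimplexCategory.eq_δ_of_mono φ
    change y.1 (objEquiv.symm (SimplexCategory.δ i)) * (faceCochain i).1 _ = _
    rw [faceCochain_δ]
    split_ifs with h
    · rw [h, mul_one]
    · rw [mul_zero, hj j h]
  · rcases (Nat.succ_le_of_lt hp).eq_or_lt with rfl | hp
    -- In top degree h (d y) = 0, since d y lies one degree above the top. It remains to compare d
    -- (h y) with y on the only injective simplex, the identity.
    · rw [topEval_of_ne i (p := n + 1 + 1) (by omega), zero_smul, add_zero, topEval_of, ← map_zsmul]
      congr 1
      refine normalized_stdSimplex_ext fun φ hφ => ?_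
      have : Mono φ := SimplexCategory.mono_iff_injective.2 hφ
      obtain rfl := SimplexCategory.eq_id_of_mono φ
      change (_ * y.1 (objEquiv.symm (𝟙 _))) * (dN n (faceCochain i)).1 _ = _
      rw [dN_faceCochain_apply_id, mul_right_comm, sq, one_mul]
    · obtain rfl : y = 0 := normalized_stdSimplex_ext fun φ hφ =>
        absurd hφ (not_injective_of_lt hp φ)
      simp only [map_zero, zero_smul, add_zero]

/-- The contraction of the restriction from `Δ[n + 1]` to a horn. -/
def hornContraction :
    (normalizationMap (cochainRingMap (SSet.horn.{u} (n + 1) i).ι)).Contraction where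
  s := extendByZeroN _
  s_mem := extendByZeroN_mem _
  map_s := mapN_extendByZeroN _
  h := hornHomotopy i
  h_mem hkl hy := hornHomotopy_mem i hkl hy
  map_h := mapN_hornHomotopy i
  d_h_add_h_d (y : Normalization (cochainRing.{u} Δ[n + 1])) := by
    -- The map 1 - s f is named as an additive homomorphism so that the identity can be checked on
    -- homogeneous summands. Its values vanish on the horn.
    let r : Normalization (cochainRing.{u} Δ[n + 1]) →+ Normalization (cochainRing.{u} Δ[n + 1]) :=
      AddMonoidHom.id _ -
        (extendByZeroN _).comp (mapN (cochainRingMap (SSet.horn.{u} (n + 1) i).ι))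
    change differentialN _ (hornHomotopy i (r y)) + hornHomotopy i (differentialN _ (r y)) = r y
    induction y using DirectSum.induction_on with
    | zero => simp only [map_zero, add_zero]
    | add a b ha hb =>
      simp only [map_add]
      rw [add_add_add_comm, ha, hb]
    | of p y =>
      have e : r (DirectSum.of _ p y) = DirectSum.of _ p (y - extendByZero _ p
          (normalizedMap (cochainRingMap (SSet.horn.{u} (n + 1) i).ι) p y)) := by
        rw [map_sub, ← extendByZeroN_of, ← mapN_of]; rfl
      rw [e]
      refine differentialN_hornHomotopy i _ fun z hz => ?_
      change y.1 z - (extendByZero _ p _).1 z = 0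
      rw [extendByZero_apply _ _ hz, normalizedMap_ι_apply, sub_self]

end Horn

end DGRing

end

theorem mainTheorem6 (q : ℕ) (hq : 1 ≤ q) (i : Fin (q + 1)) (B : DGRing.{v}) :
    Function.Surjective (DGRing.ofSSetMap (SSet.horn.{u} q i).ι B).toRingHom ∧
      QuasiIso (DGRing.ofSSetMap (SSet.horn.{u} q i).ι B).toComplexMap := by
  -- Positivity of q provides the face of dimension q - 1 that pairs with the top simplex; for q = 0
  -- the horn is empty.
  obtain ⟨n, rfl⟩ := Nat.exists_eq_add_of_le' hq
  exact ⟨((DGRing.hornContraction i).tensor B).surjective,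
    ((DGRing.hornContraction i).tensor B).quasiIso⟩
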